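/- Let $\mathcal H$ be the set of real Gaussian processes $\{x_t\}_{t\in[0,1]}$ (on any probability space) such that $E(x_t)=0$ for all $t$, $x_0=x_1$ almost surely, and $\operatorname{Cov}(x_s,x_t)=\tilde C(s-t)$ for all $s,t\in[0,1]$, for some continuous function $\tilde C:\mathbb R\to\mathbb R$. Let $Z=((\bar Y_n)_{n\ge 0},(\bar Y'_n)_{n\ge 0})$ be two independent sequences of independent standard Gaussian random variables on a probability space $(\Omega,\mathcal F,P)$, and let $\mathcal H_Z$ be the set of processes $\{x_t\}_{t\in[0,1]}\in\mathcal H$ on $(\Omega,\mathcal F,P)$ for which there is a sequence $(a_n)_{n\ge0}\in\ell^2$ with $$x_t = a_0\bar Y'_0+\sqrt2\sum_{k=1}^\infty a_k\big(\bar Y_k\sin(2k\pi t)+\bar Y'_k\cos(2k\pi t)\big),$$ the limit being in mean square, uniformly in $t\in[0,1]$. Then: 1. For every $\{z_t\}_{t\in[0,1]}\in\mathcal H$ there is $\{x_t\}_{t\in[0,1]}\in\mathcal H_Z$ with the same law, that is, the same distribution on $\mathbb R^{[0,1]}$ with the product $\sigma$-algebra. 2. For every $(a_n)\in\ell^2$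 the series above converges in mean square, uniformly in $t$, to a process in $\mathcal H_Z$, which is unique up to modification. When processes that are modifications of each other are identified, the map $(a_n)\mapsto\{x_t\}$ is a linear bijection from $\ell^2$ onto $\mathcal H_Z$. It is an isometry when $\mathcal H_Z$ carries the norm $\|x\|_{\mathcal H}=\big(\int_0^1E(x_t^2)\,dt\big)^{1/2}$ and $\ell^2$ carries the norm $\big(a_0^2+2\sum_{n\ge1}a_n^2\big)^{1/2}$: if $x$ and $y$ are the processes with coefficients $(a_n)$ and $(b_n)$, then $$\|x\|_{\mathcal H}=\sqrt{a_0^2+2\sum_{n\ge1}a_n^2},\qquad \|x-y\|_{\mathcal H}=\sqrt{(a_0-b_0)^2+2\sum_{n\ge1}(a_n-b_n)^2},$$ where $E(x_t^2)<\infty$ for all $t$ and $t\mapsto E(x_t^2)$ is integrable on $[0,1]$. -/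

import Mathlib

open MeasureTheory ProbabilityTheory Filter Topology
open scoped ENNReal unitInterval

noncomputable section

namespace GaussPeriodic

/-- The space `ℓ²` of square-summable real sequences `(a_n)_{n ≥ 0}`. -/
abbrev EllTwo : Type := lp (fun _ : ℕ => ℝ) 2

/-- The set `H` of centred real Gaussian processes `{x_t}`, `t ∈ [0,1]`, on `(Ω, P)` with
covariance `C(s,t) = c(s - t)` for a continuous `c`, and with `x_0 = x_1` almost surely.
A process is a family of (measurable) random variables. -/
structure MemH {Ω : Type*} [MeasurableSpace Ω] (P : Measure Ω) (x : I → Ω → ℝ) : Prop where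
  measurable : ∀ t, Measurable (x t)
  gaussian : IsGaussianProcess x P
  centered : ∀ t, ∫ ω, x t ω ∂P = 0
  stationary : ∃ c : ℝ → ℝ, Continuous c ∧ ∀ s t : I, cov[x s, x t; P] = c ((s : ℝ) - t)
  periodic : x 0 =ᵐ[P] x 1

/-- `(Y_n)` and `(Y'_n)` are two independent sequences of independent standard Gaussian
random variables. -/
structure IsGaussianCouple {Ω : Type*} [MeasurableSpace Ω] (P : Measure Ω)
    (Y Y' : ℕ → Ω → ℝ) : Prop where
  measurable_left : ∀ n, Measurable (Y n)
  measurable_right : ∀ n, Measurable (Y' n)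
  law_left : ∀ n, P.map (Y n) = gaussianReal 0 1
  law_right : ∀ n, P.map (Y' n) = gaussianReal 0 1
  indep_left : iIndepFun Y P
  indep_right : iIndepFun Y' P
  indep : IndepFun (fun ω n => Y n ω) (fun ω n => Y' n ω) P

/-- `a_0 Y'_0 + √2 ∑_{k=1}^n a_k (Y_k sin 2kπt + Y'_k cos 2kπt)`. -/
def partialSum {Ω : Type*} (Y Y' : ℕ → Ω → ℝ) (a : ℕ → ℝ) (n : ℕ) (t : I) (ω : Ω) : ℝ :=
  a 0 * Y' 0 ω + √2 * ∑ k ∈ Finset.Icc 1 n,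
    a k * (Y k ω * Real.sin (2 * k * Real.pi * t) + Y' k ω * Real.cos (2 * k * Real.pi * t))

/-- The process `x` is the sum of the trigonometric series with coefficients `a`, the limit being
in mean square, uniformly in `t ∈ [0,1]`. -/
def HasExpansion {Ω : Type*} [MeasurableSpace Ω] (P : Measure Ω) (Y Y' : ℕ → Ω → ℝ)
    (a : ℕ → ℝ) (x : I → Ω → ℝ) : Prop :=
  Tendsto (fun n => ⨆ t : I, eLpNorm (fun ω => x t ω - partialSum Y Y' a n t ω) 2 P)
    atTop (𝓝 0)

/-- The set `H_Z` for `Z = ((Y_n), (Y'_n))`. -/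
def HZ {Ω : Type*} [MeasurableSpace Ω] (P : Measure Ω) (Y Y' : ℕ → Ω → ℝ) :
    Set (I → Ω → ℝ) :=
  {x | MemH P x ∧ ∃ a : EllTwo, HasExpansion P Y Y' a x}

/-- The inner product `∫₀¹ E(x_t y_t) dt`. -/
def hInner {Ω : Type*} [MeasurableSpace Ω] (P : Measure Ω) (x y : I → Ω → ℝ) : ℝ :=
  ∫ t : I, ∫ ω, x t ω * y t ω ∂P

/-- The norm of `H`, given by the inner product. -/
def hNorm {Ω : Type*} [MeasurableSpace Ω] (P : Measure Ω) (x : I → Ω → ℝ) : ℝ :=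
  √(hInner P x x)

/-- The norm `√(a_0² + 2 ∑_{n ≥ 1} a_n²)` on `ℓ²`. -/
def coeffNorm (a : EllTwo) : ℝ :=
  √((a 0) ^ 2 + 2 * ∑' n : ℕ, (a (n + 1)) ^ 2)

/-- Processes up to modification: families indexed by `t ∈ [0,1]` of classes of random variables
modulo almost sure equality. -/
abbrev ProcessClass (Ω : Type*) [MeasurableSpace Ω] (P : Measure Ω) : Type _ :=
  I → (Ω →ₘ[P] ℝ)

/-- The process `x` is a representative of the class `X`. -/
def Represents {Ω : Type*} [MeasurableSpace Ω] {P : Measure Ω} (x : I → Ω → ℝ)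
    (X : ProcessClass Ω P) : Prop :=
  (∀ t, Measurable (x t)) ∧ ∀ t, x t =ᵐ[P] X t

/-- The classes modulo modification of the processes in `H_Z`. -/
def HZClass {Ω : Type*} [MeasurableSpace Ω] (P : Measure Ω) (Y Y' : ℕ → Ω → ℝ) :
    Set (ProcessClass Ω P) :=
  {X | ∃ x ∈ HZ P Y Y', Represents x X}

end GaussPeriodic

end

/-! At a fixed time the random waves Y_k sin 2kπt + Y'_k cos 2kπt are orthonormal in L²(P), since
sin² + cos² = 1. Up to a factor √2 and a correction at k = 0, the series is thus an isometric image
of its coefficients (`waveIsometry`), and the error after n terms is √2 times the norm of the tail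
of a, whatever t is: uniformity is free (`eLpNorm_sub_partialSum`). Gaussianity survives mean square
limits, the covariance of the sum is `covFun a (s - t)`, and its value at 0 is the square of
`coeffNorm a`. This gives membership in H, the isometry, and from it injectivity.

For the statement on laws, mean and covariance determine a Gaussian process, so it suffices that
every covariance in H is some `covFun a`. This is Bochner's theorem on the circle
(`eq_covFun_sqrt_cosCoeff`). The process is a curve z in L² with inner products c(s - t). Its cosine
coefficients `cosVec z k` are orthogonal with squared norm a positive multiple of the k-th cosine
coefficient of c, which is therefore nonnegative. Bessel's inequality bounds the sum of these
coefficients by c(0), so the Fourier series of c converges to c, and a_k is the square root of the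
k-th coefficient. -/

noncomputable section

namespace GaussPeriodic

/-! ### Mean square limits and laws of Gaussian processes. -/

section GaussianLimits

variable {Ω : Type*} [MeasurableSpace Ω] {P : Measure Ω}

/-- The inner product of `L²` as a covariance-type integral. -/
lemma inner_toLp {f g : Ω → ℝ} (hf : MemLp f 2 P) (hg : MemLp g 2 P) :
    inner ℝ (hf.toLp f) (hg.toLp g) = ∫ ω, f ω * g ω ∂P := by
  rw [L2.inner_def]
  refine integral_congr_ae ?_
  filter_upwards [hf.coeFn_toLp, hg.coeFn_toLp] with ω h1 h2
  simp [h1, h2, mul_comm]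

variable [IsProbabilityMeasure P]

/-- A limit in mean square of real Gaussian random variables is Gaussian. -/
lemma hasGaussianLaw_of_tendsto {X : ℕ → Ω → ℝ} {x : Ω → ℝ} (hX : ∀ n, HasGaussianLaw (X n) P)
    (hx : MemLp x 2 P) (h : Tendsto (fun n => eLpNorm (X n - x) 2 P) atTop (𝓝 0)) :
    HasGaussianLaw x P := by
  have hXm : ∀ n, MemLp (X n) 2 P := fun n => (hX n).memLp_two
  have hLp : Tendsto (fun n => (hXm n).toLp (X n)) atTop (𝓝 (hx.toLp x)) :=
    (Lp.tendsto_Lp_iff_tendsto_eLpNorm'' X hXm x hx).2 h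
  have h1 : MemLp (fun _ : Ω => (1 : ℝ)) 2 P := memLp_const 1
  -- Means and second moments are inner products in L², hence continuous under mean square
  -- convergence.
  have hmean : Tendsto (fun n => P[X n]) atTop (𝓝 (P[x])) := by
    have := hLp.inner (𝕜 := ℝ) (tendsto_const_nhds (x := h1.toLp _))
    simpa only [inner_toLp, mul_one] using this
  have hvar : Tendsto (fun n => Var[X n; P]) atTop (𝓝 (Var[x; P])) := by
    have h2 := (hLp.inner (𝕜 := ℝ) hLp).sub (hmean.pow 2)
    simp only [inner_toLp] at h2
    simpa only [variance_eq_sub, hXm, hx, Pi.pow_apply, pow_two] using h2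
  rw [hasGaussianLaw_iff_charFun_map_eq hx.aemeasurable]
  intro t
  -- Mean square convergence implies convergence in distribution; the Gaussian characteristic
  -- functions then have two limits, which must agree.
  have hdist : TendstoInDistribution X atTop x (fun _ => P) P :=
    (tendstoInMeasure_of_tendsto_eLpNorm (by norm_num)
      (fun n => (hXm n).aestronglyMeasurable) hx.aestronglyMeasurable h).tendstoInDistribution
      fun n => (hX n).aemeasurable
  have hchar := (ProbabilityMeasure.tendsto_iff_tendsto_charFun.1 hdist.tendsto) t
  refine tendsto_nhds_unique hchar ?_
  have hmean' : ∀ f : Ω → ℝ, P[fun ω => inner ℝ t (f ω)] = t * P[f] := fun f => by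
    simp [integral_const_mul, mul_comm]
  have hvar' : ∀ f : Ω → ℝ, Var[fun ω => inner ℝ t (f ω); P] = t ^ 2 * Var[f; P] := fun f => by
    rw [← variance_const_mul]; simp [mul_comm]
  simp only [ProbabilityMeasure.coe_mk, (hX _).charFun_map_eq, hmean', hvar']
  refine (Complex.continuous_exp.tendsto _).comp (Tendsto.sub ?_ ?_)
  · exact ((Complex.continuous_ofReal.tendsto _).comp (hmean.const_mul t)).mul_const _
  · exact ((Complex.continuous_ofReal.tendsto _).comp (hvar.const_mul (t ^ 2))).div_const _

lemma dual_apply_eq_sum {ι : Type*} [Fintype ι] [DecidableEq ι] (L : StrongDual ℝ (ι → ℝ))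
    (v : ι → ℝ) : L v = ∑ i, L (Pi.single i 1) * v i := by
  conv_lhs => rw [pi_eq_sum_univ' v]
  simp [map_sum, mul_comm, Pi.single]

/-- A pointwise limit in mean square of real Gaussian processes is a Gaussian process. -/
lemma isGaussianProcess_of_tendsto {T : Type*} {X : ℕ → T → Ω → ℝ} {x : T → Ω → ℝ}
    (hX : ∀ n, IsGaussianProcess (X n) P) (hx : ∀ t, MemLp (x t) 2 P)
    (h : ∀ t, Tendsto (fun n => eLpNorm (X n t - x t) 2 P) atTop (𝓝 0)) :
    IsGaussianProcess x P where
  hasGaussianLaw K := by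
    classical
    have hK : AEMeasurable (fun ω => K.restrict (x · ω)) P :=
      aemeasurable_pi_lambda _ fun i => (hx i).aemeasurable
    refine ⟨⟨fun L => ?_⟩⟩
    -- A finite-dimensional marginal is Gaussian once each of its linear forms is, and each form is
    -- a mean square limit of Gaussian variables.
    have hL : HasGaussianLaw (fun ω => L (K.restrict (x · ω))) P := by
      have hsum : ∀ y : T → Ω → ℝ, (fun ω => L (K.restrict (y · ω))) =
          ∑ i : K, fun ω => L (Pi.single i 1) * y i ω := fun y => by
        ext ω
        rw [dual_apply_eq_sum]
        simp
      have hmem : ∀ y : T → Ω → ℝ, (∀ t, MemLp (y t) 2 P) →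
          MemLp (fun ω => L (K.restrict (y · ω))) 2 P := fun y hy => by
        rw [hsum]
        exact memLp_finsetSum' _ fun i _ => (hy i).const_mul _
      refine hasGaussianLaw_of_tendsto (X := fun n ω => L (K.restrict (X n · ω)))
        (fun n => ((hX n).hasGaussianLaw K).map_fun L) (hmem x hx) ?_
      have hb : ∀ n, eLpNorm ((fun ω => L (K.restrict (X n · ω))) -
          fun ω => L (K.restrict (x · ω))) 2 P ≤
          ∑ i : K, ‖L (Pi.single i 1)‖ₑ * eLpNorm (X n i - x i) 2 P := fun n => by
        have : (fun ω => L (K.restrict (X n · ω))) - (fun ω => L (K.restrict (x · ω))) =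
            ∑ i : K, L (Pi.single i 1) • (X n i - x i) := by
          rw [hsum, hsum, ← Finset.sum_sub_distrib]
          exact Finset.sum_congr rfl fun i _ => by ext ω; simp [mul_sub]
        rw [this]
        refine (eLpNorm_sum_le (fun i _ => ?_) (by norm_num)).trans
          (Finset.sum_le_sum fun i _ => (eLpNorm_const_smul _ _ _ _).le)
        exact ((((hX n).aemeasurable i).sub (hx i).aemeasurable).const_smul
          _).aestronglyMeasurable
      refine tendsto_of_tendsto_of_tendsto_of_le_of_le tendsto_const_nhds ?_
        (fun _ => zero_le) hb
      have := tendsto_finsetSum (Finset.univ : Finset K) fun i _ =>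
        ENNReal.Tendsto.const_mul (a := ‖L (Pi.single i 1)‖ₑ) (h i) (Or.inr (by simp))
      simpa using this
    rw [AEMeasurable.map_map_of_aemeasurable (by fun_prop) hK,
      integral_map hK (by fun_prop), variance_map (by fun_prop) hK]
    exact hL.map_eq_gaussianReal

/-- The law of a real Gaussian process is determined by its mean and its covariance. -/
lemma identDistrib_of_isGaussianProcess {Ω' : Type*} [MeasurableSpace Ω'] {Q : Measure Ω'}
    [IsProbabilityMeasure Q] {T : Type*} {x : T → Ω → ℝ} {y : T → Ω' → ℝ}
    (hx : IsGaussianProcess x P) (hy : IsGaussianProcess y Q)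
    (hxm : ∀ t, Measurable (x t)) (hym : ∀ t, Measurable (y t))
    (hmean : ∀ t, P[x t] = Q[y t]) (hcov : ∀ s t, cov[x s, x t; P] = cov[y s, y t; Q]) :
    IdentDistrib (fun ω t => x t ω) (fun ω t => y t ω) P Q := by
  classical
  have hxp : AEMeasurable (fun ω t => x t ω) P := (measurable_pi_lambda _ hxm).aemeasurable
  have hyp : AEMeasurable (fun ω t => y t ω) Q := (measurable_pi_lambda _ hym).aemeasurable
  refine ⟨hxp, hyp, ?_⟩
  -- A law on the product σ-algebra is determined by its finite-dimensional marginals, here compared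
  -- through their characteristic functions.
  refine (isProjectiveLimit_map hxp).unique fun K => ?_
  rw [AEMeasurable.map_map_of_aemeasurable (by fun_prop) hyp]
  symm
  change P.map (fun ω => K.restrict (x · ω)) = Q.map (fun ω => K.restrict (y · ω))
  have hgx := hx.hasGaussianLaw K
  have hgy := hy.hasGaussianLaw K
  have := hgx.isGaussian_map
  have := hgy.isGaussian_map
  have hmx : ∀ t, MemLp (x t) 2 P := fun t => (hx.hasGaussianLaw_eval t).memLp_two
  have hmy : ∀ t, MemLp (y t) 2 Q := fun t => (hy.hasGaussianLaw_eval t).memLp_two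
  refine Measure.ext_of_charFunDual ?_
  ext L
  rw [hgx.charFunDual_map_eq_fun, hgy.charFunDual_map_eq_fun]
  have hxi : ∀ i : K, MemLp (fun ω => L (Pi.single i 1) * x i ω) 2 P :=
    fun i => (hmx i).const_mul _
  have hyi : ∀ i : K, MemLp (fun ω => L (Pi.single i 1) * y i ω) 2 Q :=
    fun i => (hmy i).const_mul _
  simp only [fun ω => dual_apply_eq_sum L (K.restrict (x · ω)),
    fun ω => dual_apply_eq_sum L (K.restrict (y · ω)), Finset.restrict]
  rw [integral_finsetSum _ fun i _ => (hxi i).integrable (by norm_num),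
    integral_finsetSum _ fun i _ => (hyi i).integrable (by norm_num),
    ← covariance_self (Finset.aemeasurable_fun_sum _ fun i _ => (hxi i).aemeasurable),
    ← covariance_self (Finset.aemeasurable_fun_sum _ fun i _ => (hyi i).aemeasurable),
    covariance_fun_sum_fun_sum hxi hxi, covariance_fun_sum_fun_sum hyi hyi]
  simp only [integral_const_mul, covariance_const_mul_left, covariance_const_mul_right, hmean,
    hcov]

end GaussianLimits

/-! ### Random waves: moments, orthonormality and Gaussian partial sums. -/

section Series

variable {Ω : Type*} [MeasurableSpace Ω] {P : Measure Ω} {Y Y' : ℕ → Ω → ℝ}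

/-- The `k`-th random wave `Y_k sin 2kπt + Y'_k cos 2kπt`. -/
def wave {Ω : Type*} (Y Y' : ℕ → Ω → ℝ) (t : I) (k : ℕ) (ω : Ω) : ℝ :=
  Y k ω * Real.sin (2 * k * Real.pi * t) + Y' k ω * Real.cos (2 * k * Real.pi * t)

/-- The wave of index 0 is Y'_0, so the constant term can join the others under the common factor
√2; the last summand corrects its weight from √2 to 1. -/
lemma partialSum_eq_wave {Ω : Type*} {Y Y' : ℕ → Ω → ℝ} (a : ℕ → ℝ) (n : ℕ) (t : I) :
    partialSum Y Y' a n t = fun ω => √2 * ∑ k ∈ Finset.range (n + 1), a k * wave Y Y' t k ω +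
      (1 - √2) * (a 0 * wave Y Y' t 0 ω) := by
  ext ω
  have h : Finset.range (n + 1) = insert 0 (Finset.Icc 1 n) := by
    ext k; simp; omega
  rw [h, Finset.sum_insert (by simp)]
  simp only [partialSum, wave]
  simp
  ring

section Moments

lemma integral_eq_zero_of_map {y : Ω → ℝ} (hy : Measurable y)
    (h : P.map y = gaussianReal 0 1) : ∫ ω, y ω ∂P = 0 := by
  have := integral_map (f := fun z : ℝ => z) hy.aemeasurable (μ := P) (by fun_prop)
  rw [← this, h, integral_id_gaussianReal]

lemma integral_mul_self_of_map {y : Ω → ℝ} (hy : Measurable y)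
    (h : P.map y = gaussianReal 0 1) : ∫ ω, y ω * y ω ∂P = 1 := by
  have h1 := integral_map (f := fun z : ℝ => z * z) hy.aemeasurable (μ := P) (by fun_prop)
  have h2 := variance_id_gaussianReal (μ := 0) (v := 1)
  rw [variance_of_integral_eq_zero (by fun_prop) (by simp)] at h2
  rw [← h1, h]
  simpa [pow_two] using h2

lemma IsGaussianCouple.hasGaussianLaw_left (hZ : IsGaussianCouple P Y Y') (k : ℕ) :
    HasGaussianLaw (Y k) P :=
  ⟨by rw [hZ.law_left]; infer_instance⟩

lemma IsGaussianCouple.hasGaussianLaw_right (hZ : IsGaussianCouple P Y Y') (k : ℕ) :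
    HasGaussianLaw (Y' k) P :=
  ⟨by rw [hZ.law_right]; infer_instance⟩

lemma IsGaussianCouple.integral_left_mul_left (hZ : IsGaussianCouple P Y Y') (k l : ℕ) :
    ∫ ω, Y k ω * Y l ω ∂P = if k = l then 1 else 0 := by
  split_ifs with h
  · subst h
    exact integral_mul_self_of_map (hZ.measurable_left k) (hZ.law_left k)
  · rw [(hZ.indep_left.indepFun h).integral_fun_mul_eq_mul_integral
      (hZ.measurable_left k).aestronglyMeasurable (hZ.measurable_left l).aestronglyMeasurable,
      integral_eq_zero_of_map (hZ.measurable_left k) (hZ.law_left k), zero_mul]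

lemma IsGaussianCouple.integral_right_mul_right (hZ : IsGaussianCouple P Y Y') (k l : ℕ) :
    ∫ ω, Y' k ω * Y' l ω ∂P = if k = l then 1 else 0 := by
  split_ifs with h
  · subst h
    exact integral_mul_self_of_map (hZ.measurable_right k) (hZ.law_right k)
  · rw [(hZ.indep_right.indepFun h).integral_fun_mul_eq_mul_integral
      (hZ.measurable_right k).aestronglyMeasurable (hZ.measurable_right l).aestronglyMeasurable,
      integral_eq_zero_of_map (hZ.measurable_right k) (hZ.law_right k), zero_mul]

lemma IsGaussianCouple.integral_left_mul_right (hZ : IsGaussianCouple P Y Y') (k l : ℕ) :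
    ∫ ω, Y k ω * Y' l ω ∂P = 0 := by
  have h : IndepFun (Y k) (Y' l) P :=
    hZ.indep.comp (measurable_pi_apply k) (measurable_pi_apply l)
  rw [h.integral_fun_mul_eq_mul_integral
      (hZ.measurable_left k).aestronglyMeasurable (hZ.measurable_right l).aestronglyMeasurable,
      integral_eq_zero_of_map (hZ.measurable_left k) (hZ.law_left k), zero_mul]

lemma IsGaussianCouple.memLp_wave (hZ : IsGaussianCouple P Y Y') (t : I) (k : ℕ) :
    MemLp (wave Y Y' t k) 2 P :=
  ((hZ.hasGaussianLaw_left k).memLp_two.mul_const _).add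
    ((hZ.hasGaussianLaw_right k).memLp_two.mul_const _)

lemma IsGaussianCouple.integral_wave (hZ : IsGaussianCouple P Y Y') (t : I) (k : ℕ) :
    ∫ ω, wave Y Y' t k ω ∂P = 0 := by
  simp only [wave]
  rw [integral_add ((hZ.hasGaussianLaw_left k).integrable.mul_const _)
    ((hZ.hasGaussianLaw_right k).integrable.mul_const _), integral_mul_const, integral_mul_const,
    integral_eq_zero_of_map (hZ.measurable_left k) (hZ.law_left k),
    integral_eq_zero_of_map (hZ.measurable_right k) (hZ.law_right k)]
  simp

/-- Only the products of a variable with itself survive, and the addition formula for the cosine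
merges the two. -/
lemma IsGaussianCouple.integral_wave_mul_wave (hZ : IsGaussianCouple P Y Y') (s t : I) (k l : ℕ) :
    ∫ ω, wave Y Y' s k ω * wave Y Y' t l ω ∂P =
      if k = l then Real.cos (2 * k * Real.pi * (s - t)) else 0 := by
  have hi : ∀ {f g : Ω → ℝ}, HasGaussianLaw f P → HasGaussianLaw g P → ∀ c : ℝ,
      Integrable (fun ω => f ω * g ω * c) P := fun hf hg c =>
    (hf.memLp_two.integrable_mul hg.memLp_two).mul_const c
  have hl := hZ.hasGaussianLaw_left
  have hr := hZ.hasGaussianLaw_right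
  have hexp : ∀ ω, wave Y Y' s k ω * wave Y Y' t l ω =
      Y k ω * Y l ω * (Real.sin (2 * k * Real.pi * s) * Real.sin (2 * l * Real.pi * t)) +
      Y' k ω * Y' l ω * (Real.cos (2 * k * Real.pi * s) * Real.cos (2 * l * Real.pi * t)) +
      Y k ω * Y' l ω * (Real.sin (2 * k * Real.pi * s) * Real.cos (2 * l * Real.pi * t)) +
      Y l ω * Y' k ω * (Real.cos (2 * k * Real.pi * s) * Real.sin (2 * l * Real.pi * t)) :=
    fun ω => by simp only [wave]; ring
  simp only [hexp]
  rw [integral_add, integral_add, integral_add]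
  rotate_left
  · exact hi (hl k) (hl l) _
  · exact hi (hr k) (hr l) _
  · exact (hi (hl k) (hl l) _).add (hi (hr k) (hr l) _)
  · exact hi (hl k) (hr l) _
  · exact ((hi (hl k) (hl l) _).add (hi (hr k) (hr l) _)).add (hi (hl k) (hr l) _)
  · exact hi (hl l) (hr k) _
  simp only [integral_mul_const, hZ.integral_left_mul_left, hZ.integral_right_mul_right,
    hZ.integral_left_mul_right]
  split_ifs with h
  · subst h
    rw [mul_sub, Real.cos_sub]
    ring
  · ring

/-- The random waves at time `t`, as elements of `L²`. -/
def IsGaussianCouple.waveLp (hZ : IsGaussianCouple P Y Y') (t : I) (k : ℕ) : Lp ℝ 2 P :=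
  (hZ.memLp_wave t k).toLp _

lemma IsGaussianCouple.inner_waveLp (hZ : IsGaussianCouple P Y Y') (s t : I) (k l : ℕ) :
    inner ℝ (hZ.waveLp s k) (hZ.waveLp t l) =
      if k = l then Real.cos (2 * k * Real.pi * (s - t)) else 0 := by
  rw [waveLp, waveLp, inner_toLp, hZ.integral_wave_mul_wave]

lemma IsGaussianCouple.orthonormal_waveLp (hZ : IsGaussianCouple P Y Y') (t : I) :
    Orthonormal ℝ (hZ.waveLp t) := by
  rw [orthonormal_iff_ite]
  intro k l
  rw [hZ.inner_waveLp]
  simp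

/-- Every marginal is a linear image of the jointly Gaussian vector (Y_0, …, Y_n, Y'_0, …, Y'_n). -/
lemma IsGaussianCouple.isGaussianProcess_partialSum (hZ : IsGaussianCouple P Y Y')
    [IsProbabilityMeasure P] (a : ℕ → ℝ) (n : ℕ) :
    IsGaussianProcess (partialSum Y Y' a n) P where
  hasGaussianLaw K := by
    have h1 : HasGaussianLaw (fun ω (k : Fin (n + 1)) => Y k ω) P :=
      (hZ.indep_left.precomp Fin.val_injective).hasGaussianLaw
        fun k => hZ.hasGaussianLaw_left k
    have h2 : HasGaussianLaw (fun ω (k : Fin (n + 1)) => Y' k ω) P :=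
      (hZ.indep_right.precomp Fin.val_injective).hasGaussianLaw
        fun k => hZ.hasGaussianLaw_right k
    have h3 : HasGaussianLaw (fun ω => ((fun k : Fin (n + 1) => Y k ω),
        fun k : Fin (n + 1) => Y' k ω)) P :=
      IndepFun.hasGaussianLaw h1 h2 (hZ.indep.comp
        (φ := fun y : ℕ → ℝ => fun k : Fin (n + 1) => y k)
        (ψ := fun y : ℕ → ℝ => fun k : Fin (n + 1) => y k) (by fun_prop) (by fun_prop))
    let L : ((Fin (n + 1) → ℝ) × (Fin (n + 1) → ℝ)) →ₗ[ℝ] (K → ℝ) :=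
      { toFun p t := √2 * ∑ k : Fin (n + 1), a k *
            (p.1 k * Real.sin (2 * k * Real.pi * t) + p.2 k * Real.cos (2 * k * Real.pi * t)) +
          (1 - √2) * (a 0 * p.2 0)
        map_add' p q := by
          ext t
          simp only [Prod.fst_add, Prod.snd_add, Pi.add_apply, add_mul, mul_add,
            Finset.sum_add_distrib]
          ring
        map_smul' c p := by
          ext t
          simp only [Prod.smul_fst, Prod.smul_snd, Pi.smul_apply, smul_eq_mul, Finset.mul_sum,
            RingHom.id_apply, mul_add]
          congr 1
          · exact Finset.sum_congr rfl fun k _ => by ring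
          · ring }
    convert! h3.map_fun L.toContinuousLinearMap using 2 with ω
    ext t
    simp only [Finset.restrict, partialSum_eq_wave, LinearMap.coe_toContinuousLinearMap']
    rw [Finset.sum_range]
    simp [L, wave]

end Moments

end Series

/-! ### Weights and cosine series. -/

/-- The weights `1, √2, √2, …` of the random waves in the series. -/
def weight (k : ℕ) : ℝ := if k = 0 then 1 else √2

lemma weight_zero : weight 0 = 1 := if_pos rfl

lemma weight_succ_sq (k : ℕ) : weight (k + 1) ^ 2 = 2 := by
  simp [weight]

lemma summable_sq (a : EllTwo) : Summable fun k => a k ^ 2 := by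
  have h := (lp.memℓp a).summable (by norm_num)
  simpa using h

lemma summable_weight_sq_mul_sq (a : EllTwo) : Summable fun k => weight k ^ 2 * a k ^ 2 := by
  rw [← summable_nat_add_iff 1]
  simp only [weight_succ_sq]
  exact ((summable_nat_add_iff 1).2 (summable_sq a)).mul_left 2

lemma coeffNorm_eq_sqrt_tsum (a : EllTwo) : coeffNorm a = √(∑' k, weight k ^ 2 * a k ^ 2) := by
  rw [coeffNorm, (summable_weight_sq_mul_sq a).tsum_eq_zero_add, weight_zero, one_pow, one_mul,
    ← tsum_mul_left]
  simp only [weight_succ_sq]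

/-- The covariance function `∑ w_k² a_k² cos 2kπu`. -/
def covFun (a : ℕ → ℝ) (u : ℝ) : ℝ :=
  ∑' k : ℕ, weight k ^ 2 * a k ^ 2 * Real.cos (2 * k * Real.pi * u)

lemma continuous_covFun (a : EllTwo) : Continuous (covFun a) := by
  refine continuous_tsum (fun k => by fun_prop) (summable_weight_sq_mul_sq a) fun k u => ?_
  rw [Real.norm_eq_abs, abs_mul, abs_of_nonneg (by positivity)]
  exact mul_le_of_le_one_right (by positivity) (Real.abs_cos_le_one _)

/-! ### The sum of the series as a process, and its isometry with the coefficients. -/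

section Series

variable {Ω : Type*} [MeasurableSpace Ω] {P : Measure Ω} {Y Y' : ℕ → Ω → ℝ}
  (hZ : IsGaussianCouple P Y Y')

/-- The coefficient `a_0` as a linear form. -/
def headCoeff : EllTwo →ₗ[ℝ] ℝ where
  toFun a := a 0
  map_add' _ _ := rfl
  map_smul' _ _ := rfl

/-- The isometry `a ↦ ∑ a_k (Y_k sin 2kπt + Y'_k cos 2kπt)` from `ℓ²` to `L²`. -/
def IsGaussianCouple.waveIsometry (t : I) : EllTwo →ₗᵢ[ℝ] Lp ℝ 2 P :=
  (hZ.orthonormal_waveLp t).orthogonalFamily.linearIsometry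

lemma IsGaussianCouple.waveIsometry_single (t : I) (k : ℕ) (r : ℝ) :
    hZ.waveIsometry t (lp.single 2 k r) = r • hZ.waveLp t k := by
  simp [waveIsometry, OrthogonalFamily.linearIsometry_apply_single]

/-- The value at time `t` of the sum of the series with coefficients `a`. -/
def IsGaussianCouple.seriesLp (t : I) : EllTwo →ₗ[ℝ] Lp ℝ 2 P :=
  √2 • (hZ.waveIsometry t).toLinearMap +
    (1 - √2) • headCoeff.smulRight (hZ.waveLp t 0)

lemma IsGaussianCouple.seriesLp_apply (t : I) (a : EllTwo) :
    hZ.seriesLp t a = √2 • hZ.waveIsometry t a + (1 - √2) • a 0 • hZ.waveLp t 0 := rfl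

lemma IsGaussianCouple.hasSum_seriesLp (t : I) (a : EllTwo) :
    HasSum (fun k => (weight k * a k) • hZ.waveLp t k) (hZ.seriesLp t a) := by
  have h1 : HasSum (fun k => a k • hZ.waveLp t k) (hZ.waveIsometry t a) := by
    have h := (hZ.orthonormal_waveLp t).orthogonalFamily.hasSum_linearIsometry a
    simp only [LinearIsometry.toSpanSingleton_apply] at h
    exact h
  have h2 := (h1.const_smul √2).add
    ((hasSum_ite_eq 0 (a 0 • hZ.waveLp t 0)).const_smul (1 - √2))
  refine h2.congr_fun fun k => ?_
  by_cases hk : k = 0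
  · subst hk
    simp only [weight_zero, if_true]
    module
  · simp only [weight, hk, if_false]
    module

lemma IsGaussianCouple.inner_waveLp_seriesLp (s t : I) (k : ℕ) (a : EllTwo) :
    inner ℝ (hZ.waveLp s k) (hZ.seriesLp t a) =
      weight k * a k * Real.cos (2 * k * Real.pi * (s - t)) := by
  have h := (hZ.hasSum_seriesLp t a).mapL (innerSL ℝ (hZ.waveLp s k))
  simp only [innerSL_apply_apply, inner_smul_right, hZ.inner_waveLp] at h
  refine h.unique ?_
  convert! hasSum_ite_eq k (weight k * a k * Real.cos (2 * k * Real.pi * (s - t))) using 2 with l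
  by_cases hl : l = k
  · simp [hl]
  · simp [hl, Ne.symm hl]

lemma IsGaussianCouple.inner_seriesLp (s t : I) (a : EllTwo) :
    inner ℝ (hZ.seriesLp s a) (hZ.seriesLp t a) = covFun a (s - t) := by
  have h := (hZ.hasSum_seriesLp s a).mapL (innerSL ℝ (hZ.seriesLp t a))
  simp only [innerSL_apply_apply, inner_smul_right, real_inner_comm,
    hZ.inner_waveLp_seriesLp] at h
  rw [covFun, ← h.tsum_eq]
  exact tsum_congr fun k => by ring

lemma IsGaussianCouple.seriesLp_zero_eq_one (a : EllTwo) :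
    hZ.seriesLp 0 a = hZ.seriesLp 1 a := by
  have h : ∀ k, hZ.waveLp 0 k = hZ.waveLp 1 k := fun k => by
    have : wave Y Y' 0 k = wave Y Y' 1 k := by
      ext ω
      have h1 : (2 * k * Real.pi : ℝ) = k * (2 * Real.pi) := by ring
      have h2 : Real.sin (2 * k * Real.pi) = 0 := by
        simpa using Real.sin_nat_mul_pi (2 * k)
      simp [wave, h1 ▸ Real.cos_nat_mul_two_pi k, h2]
    simp only [waveLp, this]
  refine (hZ.hasSum_seriesLp 0 a).unique ?_
  simpa only [h] using hZ.hasSum_seriesLp 1 a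

lemma IsGaussianCouple.integral_seriesLp [IsProbabilityMeasure P] (t : I) (a : EllTwo) :
    ∫ ω, hZ.seriesLp t a ω ∂P = 0 := by
  -- The mean is the inner product with the constant 1, which is orthogonal to every wave.
  have h1 : MemLp (fun _ : Ω => (1 : ℝ)) 2 P := memLp_const 1
  have h := (hZ.hasSum_seriesLp t a).mapL (innerSL ℝ (h1.toLp _))
  have h0 : ∀ k, inner ℝ (h1.toLp _) (hZ.waveLp t k) = 0 := fun k => by
    rw [waveLp, inner_toLp]
    simpa using hZ.integral_wave t k
  simp only [innerSL_apply_apply, inner_smul_right, h0, mul_zero] at h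
  have h2 := h.unique hasSum_zero
  rw [← Lp.toLp_coeFn (hZ.seriesLp t a) (Lp.memLp _), inner_toLp] at h2
  simpa using h2

/-- The mean square distance of the partial sums to the sum of the series is the same
at all times. -/
lemma IsGaussianCouple.eLpNorm_sub_partialSum (t : I) (a : EllTwo) (n : ℕ) {x : Ω → ℝ}
    (hx : x =ᵐ[P] hZ.seriesLp t a) :
    eLpNorm (fun ω => x ω - partialSum Y Y' a n t ω) 2 P =
      ‖√2 • (a - ∑ k ∈ Finset.range (n + 1), lp.single 2 k (a k))‖ₑ := by
  have h1 : partialSum Y Y' a n t =ᵐ[P] (√2 • ∑ k ∈ Finset.range (n + 1), a k • hZ.waveLp t k +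
      (1 - √2) • a 0 • hZ.waveLp t 0 : Lp ℝ 2 P) := by
    have hm : ∀ k, MemLp (fun ω => a k * wave Y Y' t k ω) 2 P :=
      fun k => (hZ.memLp_wave t k).const_mul _
    have hs : MemLp (fun ω => ∑ k ∈ Finset.range (n + 1), a k * wave Y Y' t k ω) 2 P :=
      memLp_finsetSum _ fun k _ => hm k
    have hk : ∀ k, a k • hZ.waveLp t k = (hm k).toLp _ := fun k => rfl
    have hsum : ∑ k ∈ Finset.range (n + 1), a k • hZ.waveLp t k = hs.toLp _ := by
      refine Lp.ext ?_
      refine (Lp.coeFn_finsetSum _ _).trans ?_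
      filter_upwards [hs.coeFn_toLp, ae_all_iff.2 fun k => (hm k).coeFn_toLp] with ω e1 e2
      rw [e1, Finset.sum_apply]
      exact Finset.sum_congr rfl fun k _ => by rw [hk, e2]
    rw [partialSum_eq_wave, hsum, hk]
    exact (((hs.const_mul √2).add ((hm 0).const_mul (1 - √2))).coeFn_toLp).symm
  -- The corrections at k = 0 cancel, leaving the isometric image of √2 times the tail of a; taking
  -- norms removes t.
  have h2 : hZ.seriesLp t a - (√2 • ∑ k ∈ Finset.range (n + 1), a k • hZ.waveLp t k +
      (1 - √2) • a 0 • hZ.waveLp t 0) =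
      hZ.waveIsometry t (√2 • (a - ∑ k ∈ Finset.range (n + 1), lp.single 2 k (a k))) := by
    simp only [map_smul, map_sub, map_sum, hZ.waveIsometry_single, hZ.seriesLp_apply]
    module
  rw [← (hZ.waveIsometry t).enorm_map, ← h2, Lp.enorm_def]
  refine eLpNorm_congr_ae ?_
  filter_upwards [hx, h1, Lp.coeFn_sub (hZ.seriesLp t a)
    (√2 • ∑ k ∈ Finset.range (n + 1), a k • hZ.waveLp t k +
      (1 - √2) • a 0 • hZ.waveLp t 0)] with ω e1 e2 e3
  rw [e3, Pi.sub_apply, e1, e2]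

lemma tendsto_enorm_sub_sum_single (a : EllTwo) :
    Tendsto (fun n => ‖√2 • (a - ∑ k ∈ Finset.range (n + 1), lp.single 2 k (a k))‖ₑ) atTop
      (𝓝 0) := by
  have h1 := ((lp.hasSum_single (by norm_num) a).tendsto_sum_nat).comp (tendsto_add_atTop_nat 1)
  have h2 := ((tendsto_const_nhds (x := a)).sub h1).const_smul √2
  simpa [Function.comp_def] using (continuous_enorm.tendsto _).comp h2

/-- The process, up to modification, with given coefficients. -/
def IsGaussianCouple.process : EllTwo →ₗ[ℝ] ProcessClass Ω P where
  toFun a t := (hZ.seriesLp t a : Ω →ₘ[P] ℝ)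
  map_add' a b := by ext1 t; rw [map_add]; rfl
  map_smul' c a := by ext1 t; rw [map_smul]; rfl

lemma IsGaussianCouple.tendsto_eLpNorm_partialSum (t : I) (a : EllTwo) {x : Ω → ℝ}
    (hx : x =ᵐ[P] hZ.seriesLp t a) :
    Tendsto (fun n => eLpNorm (fun ω => x ω - partialSum Y Y' a n t ω) 2 P) atTop (𝓝 0) := by
  simp only [hZ.eLpNorm_sub_partialSum t a _ hx]
  exact tendsto_enorm_sub_sum_single a

lemma IsGaussianCouple.integral_mul_of_represents {a : EllTwo} {x : I → Ω → ℝ}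
    (hx : Represents x (hZ.process a)) (s t : I) :
    ∫ ω, x s ω * x t ω ∂P = covFun a (s - t) := by
  rw [← hZ.inner_seriesLp s t, L2.inner_def]
  refine integral_congr_ae ?_
  filter_upwards [hx.2 s, hx.2 t] with ω h1 h2
  rw [h1, h2]
  simp [process, mul_comm]

lemma IsGaussianCouple.memLp_of_represents {a : EllTwo} {x : I → Ω → ℝ}
    (hx : Represents x (hZ.process a)) (t : I) : MemLp (x t) 2 P :=
  (Lp.memLp (hZ.seriesLp t a)).ae_eq (hx.2 t).symm

/-- The supremum over t is that of a constant function. -/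
lemma IsGaussianCouple.hasExpansion_of_represents {a : EllTwo} {x : I → Ω → ℝ}
    (hx : Represents x (hZ.process a)) : HasExpansion P Y Y' a x := by
  have h := fun n t => hZ.eLpNorm_sub_partialSum t a n (hx.2 t)
  simp only [HasExpansion, h, ciSup_const]
  exact tendsto_enorm_sub_sum_single a

lemma IsGaussianCouple.memH_of_represents [IsProbabilityMeasure P] {a : EllTwo} {x : I → Ω → ℝ}
    (hx : Represents x (hZ.process a)) : MemH P x := by
  have hm := hZ.memLp_of_represents hx
  have h0 : ∀ t, ∫ ω, x t ω ∂P = 0 := fun t => by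
    rw [integral_congr_ae (hx.2 t)]
    exact hZ.integral_seriesLp t a
  refine ⟨hx.1, ?_, h0, ⟨covFun a, continuous_covFun a, fun s t => ?_⟩, ?_⟩
  · refine isGaussianProcess_of_tendsto (hZ.isGaussianProcess_partialSum a) hm fun t => ?_
    simp only [eLpNorm_sub_comm _ (x t)]
    exact hZ.tendsto_eLpNorm_partialSum t a (hx.2 t)
  · rw [covariance_eq_sub (hm s) (hm t), h0, zero_mul, sub_zero]
    exact hZ.integral_mul_of_represents hx s t
  · refine (hx.2 0).trans ((hx.2 1).trans ?_).symm
    simp only [process, LinearMap.coe_mk, AddHom.coe_mk, hZ.seriesLp_zero_eq_one a]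
    rfl

/-- Uniqueness of mean square limits at each time; this is the uniqueness up to modification. -/
lemma IsGaussianCouple.represents_of_hasExpansion {a : EllTwo} {x : I → Ω → ℝ}
    (hx : ∀ t, Measurable (x t)) (h : HasExpansion P Y Y' a x) :
    Represents x (hZ.process a) := by
  refine ⟨hx, fun t => ?_⟩
  have h1 : Tendsto (fun n => eLpNorm (fun ω => x t ω - partialSum Y Y' a n t ω) 2 P)
      atTop (𝓝 0) :=
    tendsto_of_tendsto_of_tendsto_of_le_of_le tendsto_const_nhds h (fun _ => zero_le)
      fun n => le_iSup (fun t : I => eLpNorm (fun ω => x t ω - partialSum Y Y' a n t ω) 2 P) t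
  have h2 := hZ.tendsto_eLpNorm_partialSum t a (ae_eq_refl (hZ.seriesLp t a : Ω → ℝ))
  have hp : ∀ n, Measurable (partialSum Y Y' a n t) := fun n => by
    have := hZ.measurable_left
    have := hZ.measurable_right
    unfold partialSum
    fun_prop
  have hs : AEStronglyMeasurable (hZ.seriesLp t a) P := Lp.aestronglyMeasurable _
  have h3 : eLpNorm (x t - (hZ.seriesLp t a : Ω → ℝ)) 2 P = 0 := by
    refine le_antisymm (ge_of_tendsto' (by simpa using h1.add h2) fun n => ?_) zero_le
    have he : x t - (hZ.seriesLp t a : Ω → ℝ) = (fun ω => x t ω - partialSum Y Y' a n t ω) -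
        fun ω => hZ.seriesLp t a ω - partialSum Y Y' a n t ω := by
      ext ω; simp
    rw [he]
    exact eLpNorm_sub_le ((hx t).sub (hp n)).aestronglyMeasurable
      (hs.sub (hp n).aestronglyMeasurable) (by norm_num)
  rw [eLpNorm_eq_zero_iff ((hx t).aestronglyMeasurable.sub hs) (by norm_num)] at h3
  filter_upwards [h3] with ω hω
  exact sub_eq_zero.1 hω

lemma IsGaussianCouple.represents_process_iff [IsProbabilityMeasure P] (a : EllTwo)
    (x : I → Ω → ℝ) :
    Represents x (hZ.process a) ↔ MemH P x ∧ HasExpansion P Y Y' a x :=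
  ⟨fun h => ⟨hZ.memH_of_represents h, hZ.hasExpansion_of_represents h⟩,
    fun h => hZ.represents_of_hasExpansion h.1.measurable h.2⟩

lemma exists_represents (X : ProcessClass Ω P) : ∃ x, Represents x X :=
  ⟨fun t => X t, fun t => (X t).measurable, fun _ => ae_eq_refl _⟩

lemma IsGaussianCouple.hNorm_of_represents [IsProbabilityMeasure P] {a : EllTwo} {x : I → Ω → ℝ}
    (hx : Represents x (hZ.process a)) :
    Integrable (fun t : I => ∫ ω, x t ω * x t ω ∂P) ∧ hNorm P x = coeffNorm a := by
  -- By stationarity the second moment is the covariance function at 0, so the integral over t is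
  -- that of a constant.
  have h : ∀ t, ∫ ω, x t ω * x t ω ∂P = ∑' k, weight k ^ 2 * a k ^ 2 := fun t => by
    rw [hZ.integral_mul_of_represents hx]
    simp [covFun]
  simp only [hNorm, hInner, h, coeffNorm_eq_sqrt_tsum]
  exact ⟨integrable_const _, by simp⟩

lemma eq_zero_of_coeffNorm_eq_zero {a : EllTwo} (h : coeffNorm a = 0) : a = 0 := by
  have hnn : ∀ k, 0 ≤ weight k ^ 2 * a k ^ 2 := fun k => by positivity
  rw [coeffNorm_eq_sqrt_tsum, Real.sqrt_eq_zero (tsum_nonneg hnn)] at h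
  have h2 := (hasSum_zero_iff_of_nonneg hnn).1 (h ▸ (summable_weight_sq_mul_sq a).hasSum)
  ext k
  have h3 := congrFun h2 k
  have hw : weight k ≠ 0 := by unfold weight; split_ifs <;> simp
  simpa [hw] using h3

/-- If a has the zero process as its image, then `coeffNorm a` is the norm of the zero process. -/
lemma IsGaussianCouple.process_injective [IsProbabilityMeasure P] :
    Function.Injective hZ.process := by
  rw [injective_iff_map_eq_zero]
  intro a ha
  have h0 : Represents (0 : I → Ω → ℝ) (hZ.process a) := by
    refine ⟨fun t => measurable_const, fun t => ?_⟩
    rw [ha]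
    exact AEEqFun.coeFn_zero.symm
  refine eq_zero_of_coeffNorm_eq_zero ?_
  rw [← (hZ.hNorm_of_represents h0).2]
  simp [hNorm, hInner]

lemma IsGaussianCouple.represents_sub {a b : EllTwo} {x y : I → Ω → ℝ}
    (hx : Represents x (hZ.process a)) (hy : Represents y (hZ.process b)) :
    Represents (x - y) (hZ.process (a - b)) := by
  refine ⟨fun t => (hx.1 t).sub (hy.1 t), fun t => ?_⟩
  rw [map_sub]
  exact ((hx.2 t).sub (hy.2 t)).trans (AEEqFun.coeFn_sub _ _).symm

lemma IsGaussianCouple.range_process [IsProbabilityMeasure P] :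
    Set.range hZ.process = HZClass P Y Y' := by
  ext X
  constructor
  · rintro ⟨a, rfl⟩
    obtain ⟨x, hx⟩ := exists_represents (hZ.process a)
    have h := (hZ.represents_process_iff a x).1 hx
    exact ⟨x, ⟨h.1, a, h.2⟩, hx⟩
  · rintro ⟨x, ⟨hx, a, ha⟩, hX⟩
    refine ⟨a, funext fun t => AEEqFun.ext ?_⟩
    exact (((hZ.represents_process_iff a x).2 ⟨hx, ha⟩).2 t).symm.trans (hX.2 t)

end Series

/-! ### Bochner's theorem on the circle, for even continuous functions. -/

section Bochner

open Real

lemma periodic_cos_two_nat_mul_pi (k : ℕ) :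
    Function.Periodic (fun u : ℝ => cos (2 * k * π * u)) 1 :=
  fun u => by
    change cos (2 * k * π * (u + 1)) = _
    rw [show 2 * k * π * (u + 1) = 2 * k * π * u + k * (2 * π) by ring, cos_add_nat_mul_two_pi]

lemma periodic_sin_two_nat_mul_pi (k : ℕ) :
    Function.Periodic (fun u : ℝ => sin (2 * k * π * u)) 1 :=
  fun u => by
    change sin (2 * k * π * (u + 1)) = _
    rw [show 2 * k * π * (u + 1) = 2 * k * π * u + k * (2 * π) by ring, sin_add_nat_mul_two_pi]

lemma integral_cos_two_int_mul_pi (m : ℤ) :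
    ∫ u in (0 : ℝ)..1, cos (2 * m * π * u) = if m = 0 then 1 else 0 := by
  split_ifs with h
  · simp [h]
  · have hm : (2 * m * π : ℝ) ≠ 0 := by simp [h, pi_ne_zero]
    rw [intervalIntegral.integral_comp_mul_left _ hm, integral_cos]
    have : sin (2 * m * π) = 0 := by simpa using sin_int_mul_pi (2 * m)
    simp [this]

lemma weight_sq_pos (k : ℕ) : 0 < weight k ^ 2 := by
  have : weight k ≠ 0 := by unfold weight; split_ifs <;> simp
  positivity

/-- The functions `weight k` · cos 2kπu are orthonormal on [0,1], which is why the squared weights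
enter the cosine series. -/
lemma integral_cos_mul_cos (k l : ℕ) :
    ∫ u in (0 : ℝ)..1, cos (2 * k * π * u) * cos (2 * l * π * u) =
      if k = l then (weight k ^ 2)⁻¹ else 0 := by
  have h : ∀ u : ℝ, cos (2 * k * π * u) * cos (2 * l * π * u) =
      2⁻¹ * (cos (2 * ((k - l : ℤ) : ℝ) * π * u) + cos (2 * ((k + l : ℤ) : ℝ) * π * u)) :=
    fun u => by
    have h1 : 2 * ((k - l : ℤ) : ℝ) * π * u = 2 * k * π * u - 2 * l * π * u := by push_cast; ring
    have h2 : 2 * ((k + l : ℤ) : ℝ) * π * u = 2 * k * π * u + 2 * l * π * u := by push_cast; ring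
    rw [h1, h2, cos_sub, cos_add]
    ring
  simp only [h]
  rw [intervalIntegral.integral_const_mul, intervalIntegral.integral_add
    (Continuous.intervalIntegrable (by fun_prop) _ _)
    (Continuous.intervalIntegrable (by fun_prop) _ _),
    integral_cos_two_int_mul_pi, integral_cos_two_int_mul_pi]
  by_cases hkl : k = l
  · subst hkl
    rcases k with _ | k
    · norm_num [weight_zero]
    · rw [weight_succ_sq]
      have : ¬ ((k + 1 : ℕ) + (k + 1 : ℕ) : ℤ) = 0 := by omega
      simp only [this, sub_self, if_true, if_false]
      norm_num
  · have h1 : ¬ ((k : ℤ) - l = 0) := by omega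
    have h2 : ¬ ((k : ℤ) + l = 0) := by omega
    simp [h1, h2, hkl]

/-- The `k`-th cosine coefficient of a function of period `1`. -/
def cosCoeff (c : ℝ → ℝ) (k : ℕ) : ℝ := ∫ u in (0 : ℝ)..1, c u * cos (2 * k * π * u)

variable {c : ℝ → ℝ}

lemma integral_mul_sin_eq_zero (hper : Function.Periodic c 1) (heven : ∀ u, c (-u) = c u) (k : ℕ) :
    ∫ u in (0 : ℝ)..1, c u * sin (2 * k * π * u) = 0 := by
  set g : ℝ → ℝ := fun u => c u * sin (2 * k * π * u) with hg
  have hgper : Function.Periodic g 1 := hper.mul (periodic_sin_two_nat_mul_pi k)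
  have h1 : ∫ u in (0 : ℝ)..1, g (-u) = ∫ u in (-1 : ℝ)..0, g u := by
    simp
  have h2 : ∫ u in (-1 : ℝ)..0, g u = ∫ u in (0 : ℝ)..1, g u := by
    simpa using hgper.intervalIntegral_add_eq (-1) 0
  have h3 : ∀ u, g (-u) = -g u := fun u => by simp [hg, heven]
  simp only [h3, intervalIntegral.integral_neg] at h1
  linarith

/-- Cosines are eigenfunctions of convolution with c: the sine part of cos 2kπ(s - u) integrates to
zero because c is even. -/
lemma integral_cos_mul_sub (hc : Continuous c) (hper : Function.Periodic c 1)
    (heven : ∀ u, c (-u) = c u) (k : ℕ) (s : ℝ) :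
    ∫ t in (0 : ℝ)..1, cos (2 * k * π * t) * c (s - t) = cosCoeff c k * cos (2 * k * π * s) := by
  set f : ℝ → ℝ := fun u => cos (2 * k * π * (s - u)) * c u with hf
  have hfper : Function.Periodic f 1 := fun u => by
    have h := periodic_cos_two_nat_mul_pi k (s - (u + 1))
    simp only [show s - (u + 1) + 1 = s - u by ring] at h
    simp only [hf, hper u, h]
  have h1 : ∫ t in (0 : ℝ)..1, f (s - t) = ∫ u in (0 : ℝ)..1, f u := by
    rw [intervalIntegral.integral_comp_sub_left]
    simpa using hfper.intervalIntegral_add_eq (s - 1) 0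
  have h2 : ∀ u, f u = cos (2 * k * π * s) * (c u * cos (2 * k * π * u)) +
      sin (2 * k * π * s) * (c u * sin (2 * k * π * u)) := fun u => by
    simp only [hf, mul_sub, cos_sub]
    ring
  have h3 : ∫ u in (0 : ℝ)..1, f u = cosCoeff c k * cos (2 * k * π * s) := by
    simp only [h2]
    rw [intervalIntegral.integral_add (Continuous.intervalIntegrable (by fun_prop) _ _)
      (Continuous.intervalIntegrable (by fun_prop) _ _), intervalIntegral.integral_const_mul,
      intervalIntegral.integral_const_mul, integral_mul_sin_eq_zero hper heven, cosCoeff]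
    ring
  rw [← h3, ← h1]
  simp only [hf, sub_sub_cancel]

variable {H : Type*} [NormedAddCommGroup H] [InnerProductSpace ℝ H]
  {z : ℝ → H}

lemma even_of_inner_eq (hz : ∀ s t, inner ℝ (z s) (z t) = c (s - t)) (u : ℝ) : c (-u) = c u := by
  have h1 := hz 0 u
  have h2 := hz u 0
  rw [real_inner_comm] at h1
  simp only [zero_sub, sub_zero] at h1 h2
  rw [← h1, h2]

/-- The squared distance of z(s) and z(t) is 2c(0) - 2c(s - t). Continuity of z makes the vector
integrals `cosVec` meaningful. -/
lemma continuous_of_inner_eq (hc : Continuous c)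
    (hz : ∀ s t, inner ℝ (z s) (z t) = c (s - t)) : Continuous z := by
  refine continuous_iff_continuousAt.2 fun t => ?_
  rw [ContinuousAt, tendsto_iff_norm_sub_tendsto_zero]
  have h : ∀ s, ‖z s - z t‖ = √(2 * c 0 - 2 * c (s - t)) := fun s => by
    rw [← Real.sqrt_sq (norm_nonneg (z s - z t)), norm_sub_sq_real, ← real_inner_self_eq_norm_sq,
      ← real_inner_self_eq_norm_sq, hz, hz, hz, sub_self, sub_self]
    congr 1
    ring
  simp only [h]
  have hcont : Continuous fun s => √(2 * c 0 - 2 * c (s - t)) := by fun_prop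
  simpa using hcont.tendsto t

variable [CompleteSpace H]

/-- The `k`-th cosine coefficient of a vector-valued function. -/
def cosVec (z : ℝ → H) (k : ℕ) : H := ∫ t in (0 : ℝ)..1, cos (2 * k * π * t) • z t

lemma inner_cosVec_right (hcz : Continuous z) (x : H) (k : ℕ) :
    inner ℝ x (cosVec z k) = ∫ t in (0 : ℝ)..1, cos (2 * k * π * t) * inner ℝ x (z t) := by
  have hi : IntervalIntegrable (fun t => cos (2 * k * π * t) • z t) volume 0 1 :=
    Continuous.intervalIntegrable (by fun_prop) _ _
  have := (innerSL ℝ x).intervalIntegral_comp_comm hi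
  simp only [innerSL_apply_apply, inner_smul_right] at this
  exact this.symm

lemma inner_cosVec_of_inner_eq (hc : Continuous c) (hper : Function.Periodic c 1)
    (hz : ∀ s t, inner ℝ (z s) (z t) = c (s - t)) (s : ℝ) (k : ℕ) :
    inner ℝ (z s) (cosVec z k) = cosCoeff c k * cos (2 * k * π * s) := by
  rw [inner_cosVec_right (continuous_of_inner_eq hc hz)]
  simp only [hz]
  exact integral_cos_mul_sub hc hper (even_of_inner_eq hz) k s

lemma inner_cosVec_cosVec (hc : Continuous c) (hper : Function.Periodic c 1)
    (hz : ∀ s t, inner ℝ (z s) (z t) = c (s - t)) (k l : ℕ) :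
    inner ℝ (cosVec z k) (cosVec z l) = if k = l then cosCoeff c k * (weight k ^ 2)⁻¹ else 0 := by
  rw [inner_cosVec_right (continuous_of_inner_eq hc hz)]
  simp only [fun t => real_inner_comm (z t) (cosVec z k), inner_cosVec_of_inner_eq hc hper hz]
  have : ∀ t : ℝ, cos (2 * l * π * t) * (cosCoeff c k * cos (2 * k * π * t)) =
      cosCoeff c k * (cos (2 * k * π * t) * cos (2 * l * π * t)) := fun t => by ring
  simp only [this, intervalIntegral.integral_const_mul, integral_cos_mul_cos, mul_ite, mul_zero]

/-- The coefficient is a positive multiple of the squared norm of `cosVec z k`. -/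
lemma cosCoeff_nonneg (hc : Continuous c) (hper : Function.Periodic c 1)
    (hz : ∀ s t, inner ℝ (z s) (z t) = c (s - t)) (k : ℕ) : 0 ≤ cosCoeff c k := by
  have h := inner_cosVec_cosVec hc hper hz k k
  have h0 : 0 ≤ cosCoeff c k * (weight k ^ 2)⁻¹ := by
    rw [if_pos rfl] at h
    exact h ▸ real_inner_self_nonneg
  exact nonneg_of_mul_nonneg_left h0 (inv_pos.2 (weight_sq_pos k))

/-- Bessel's inequality for z(0): with V its projection on the first n vectors `cosVec`, both ⟨z(0),
V⟩ and ⟨V, V⟩ equal the sum, and the squared norm of z(0) - V is nonnegative. -/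
lemma sum_cosCoeff_le (hc : Continuous c) (hper : Function.Periodic c 1)
    (hz : ∀ s t, inner ℝ (z s) (z t) = c (s - t)) (n : ℕ) :
    ∑ k ∈ Finset.range n, weight k ^ 2 * cosCoeff c k ≤ c 0 := by
  set V := ∑ k ∈ Finset.range n, weight k ^ 2 • cosVec z k with hV
  have h1 : inner ℝ (z 0) V = ∑ k ∈ Finset.range n, weight k ^ 2 * cosCoeff c k := by
    rw [hV, inner_sum]
    exact Finset.sum_congr rfl fun k _ => by
      rw [inner_smul_right, inner_cosVec_of_inner_eq hc hper hz]; simp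
  have h2 : inner ℝ V V = ∑ k ∈ Finset.range n, weight k ^ 2 * cosCoeff c k := by
    rw [hV, sum_inner]
    refine Finset.sum_congr rfl fun k hk => ?_
    rw [inner_sum]
    simp only [inner_smul_left, inner_smul_right, inner_cosVec_cosVec hc hper hz]
    simp only [mul_ite, mul_zero, Finset.sum_ite_eq, hk, if_true, conj_trivial]
    have := (weight_sq_pos k).ne'
    field_simp
  have h3 : 0 ≤ inner ℝ (z 0 - V) (z 0 - V) := real_inner_self_nonneg
  rw [inner_sub_left, inner_sub_right, inner_sub_right, real_inner_comm (z 0) V, h1, h2, hz] at h3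
  simp only [sub_self] at h3
  linarith

lemma summable_weight_sq_mul_cosCoeff (hc : Continuous c) (hper : Function.Periodic c 1)
    (hz : ∀ s t, inner ℝ (z s) (z t) = c (s - t)) : Summable fun k => weight k ^ 2 * cosCoeff c k :=
  summable_of_sum_range_le (fun k => mul_nonneg (weight_sq_pos k).le
    (cosCoeff_nonneg hc hper hz k)) (sum_cosCoeff_le hc hper hz)

lemma summable_cosCoeff (hc : Continuous c) (hper : Function.Periodic c 1)
    (hz : ∀ s t, inner ℝ (z s) (z t) = c (s - t)) : Summable (cosCoeff c) := by
  have h := summable_weight_sq_mul_cosCoeff hc hper hz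
  rw [← summable_nat_add_iff 1] at h ⊢
  simp only [weight_succ_sq] at h
  exact (summable_mul_left_iff two_ne_zero).1 h

lemma fourier_coe_eq_cos_add_sin (n : ℤ) (u : ℝ) :
    fourier (T := 1) n (u : AddCircle (1 : ℝ)) =
      (cos (2 * n * π * u) : ℝ) + (sin (2 * n * π * u) : ℝ) * Complex.I := by
  rw [fourier_coe_apply, Complex.ofReal_cos, Complex.ofReal_sin, ← Complex.exp_mul_I]
  congr 1
  push_cast
  ring

lemma fourierCoeff_lift_eq (hc : Continuous c) (hper : Function.Periodic c 1)
    (heven : ∀ u, c (-u) = c u) (n : ℤ) :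
    fourierCoeff (T := 1) (fun x => ((hper.lift x : ℝ) : ℂ)) n = cosCoeff c n.natAbs := by
  rw [fourierCoeff_eq_intervalIntegral _ n 0]
  obtain ⟨ε, h1⟩ : ∃ ε : ℂ, ∀ u : ℝ, fourier (T := 1) (-n) (u : AddCircle (1 : ℝ)) •
      ((hper.lift (u : AddCircle (1 : ℝ)) : ℝ) : ℂ) =
      ((c u * cos (2 * n.natAbs * π * u) : ℝ) : ℂ) +
        ε * ((c u * sin (2 * n.natAbs * π * u) : ℝ) : ℂ) := by
    obtain ⟨k, rfl | rfl⟩ := n.eq_nat_or_neg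
    · refine ⟨-Complex.I, fun u => ?_⟩
      have h : 2 * ((-(k : ℤ) : ℤ) : ℝ) * π * u = -(2 * k * π * u) := by push_cast; ring
      rw [fourier_coe_eq_cos_add_sin, h, cos_neg, sin_neg, Function.Periodic.lift_coe,
        Int.natAbs_natCast, smul_eq_mul]
      push_cast
      ring
    · refine ⟨Complex.I, fun u => ?_⟩
      rw [fourier_coe_eq_cos_add_sin, neg_neg, Function.Periodic.lift_coe, Int.natAbs_neg,
        Int.natAbs_natCast, smul_eq_mul, Int.cast_natCast]
      push_cast
      ring
  simp only [zero_add, h1]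
  rw [intervalIntegral.integral_add
    (Continuous.intervalIntegrable (by fun_prop) _ _)
    (Continuous.intervalIntegrable (by fun_prop) _ _), intervalIntegral.integral_const_mul,
    intervalIntegral.integral_ofReal, intervalIntegral.integral_ofReal,
    integral_mul_sin_eq_zero hper heven]
  simp [cosCoeff]

/-- A continuous even function of period `1` with summable cosine coefficients is the sum of its
cosine series. -/
lemma hasSum_cosCoeff (hc : Continuous c) (hper : Function.Periodic c 1)
    (heven : ∀ u, c (-u) = c u) (hsum : Summable (cosCoeff c)) (u : ℝ) :
    HasSum (fun k => weight k ^ 2 * cosCoeff c k * cos (2 * k * π * u)) (c u) := by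
  let f : C(AddCircle (1 : ℝ), ℂ) :=
    ⟨fun x => ((hper.lift x : ℝ) : ℂ), Complex.continuous_ofReal.comp
      (continuous_coinduced_dom.2 hc)⟩
  have hcoeff : ∀ n : ℤ, fourierCoeff f n = cosCoeff c n.natAbs :=
    fourierCoeff_lift_eq hc hper heven
  have hs : Summable (fourierCoeff f) := by
    have hs' : Summable fun k : ℕ => (cosCoeff c k : ℂ) := Complex.summable_ofReal.2 hsum
    refine Summable.of_nat_of_neg ?_ ?_ <;> simpa [hcoeff] using hs'
  have h1 := (has_pointwise_sum_fourier_series_of_summable hs (u : AddCircle (1 : ℝ))).nat_add_neg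
  have h2 : ∀ k : ℕ, fourierCoeff f k • fourier (T := 1) (k : ℤ) (u : AddCircle (1 : ℝ)) +
      fourierCoeff f (-k) • fourier (T := 1) (-k : ℤ) (u : AddCircle (1 : ℝ)) =
      ((2 * cosCoeff c k * cos (2 * k * π * u) : ℝ) : ℂ) := fun k => by
    have h : 2 * ((-(k : ℤ) : ℤ) : ℝ) * π * u = -(2 * k * π * u) := by push_cast; ring
    rw [hcoeff, hcoeff, fourier_coe_eq_cos_add_sin, fourier_coe_eq_cos_add_sin, h, cos_neg, sin_neg,
      Int.natAbs_neg, Int.natAbs_natCast, Int.cast_natCast, smul_eq_mul, smul_eq_mul]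
    push_cast
    ring
  -- Pairing n with -n counts the term n = 0 twice, hence the additional constant, subtracted again
  -- in `h4`.
  have h3 : f (u : AddCircle (1 : ℝ)) +
      fourierCoeff f 0 • fourier (T := 1) 0 (u : AddCircle (1 : ℝ)) =
      ((c u + cosCoeff c 0 : ℝ) : ℂ) := by
    rw [hcoeff, fourier_zero, smul_eq_mul, mul_one]
    change ((hper.lift (u : AddCircle (1 : ℝ)) : ℝ) : ℂ) + _ = _
    rw [Function.Periodic.lift_coe]
    simp
  rw [h3] at h1
  simp only [h2] at h1
  have h4 := (Complex.hasSum_ofReal.1 h1).sub (hasSum_ite_eq 0 (cosCoeff c 0))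
  rw [add_sub_cancel_right] at h4
  refine h4.congr_fun fun k => ?_
  rcases k with _ | k
  · simp [weight_zero]
    ring
  · simp [weight_succ_sq]

/-- Bochner's theorem on the circle. -/
theorem eq_covFun_sqrt_cosCoeff (hc : Continuous c) (hper : Function.Periodic c 1)
    (hz : ∀ s t, inner ℝ (z s) (z t) = c (s - t)) :
    (∀ k, 0 ≤ cosCoeff c k) ∧ Summable (cosCoeff c) ∧ c = covFun fun k => √(cosCoeff c k) := by
  have hsum := summable_cosCoeff hc hper hz
  refine ⟨cosCoeff_nonneg hc hper hz, hsum, funext fun u => ?_⟩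
  simp only [covFun, Real.sq_sqrt (cosCoeff_nonneg hc hper hz _)]
  exact (hasSum_cosCoeff hc hper (even_of_inner_eq hz) hsum u).tsum_eq.symm

end Bochner

/-! ### Every process in H has the law of a process in H_Z. -/

section Law

variable {Ω : Type*} [MeasurableSpace Ω] {P : Measure Ω} [IsProbabilityMeasure P]

/-- The covariance of a process in `H` is a cosine series with square-summable amplitudes. -/
theorem MemH.exists_cov_eq_covFun {z : I → Ω → ℝ} (hz : MemH P z) :
    ∃ a : EllTwo, ∀ s t : I, cov[z s, z t; P] = covFun a (s - t) := by
  obtain ⟨c, hc, hcov⟩ := hz.stationary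
  have hm : ∀ t, MemLp (z t) 2 P := fun t => (hz.gaussian.hasGaussianLaw_eval t).memLp_two
  have hinner : ∀ s t : I, inner ℝ ((hm s).toLp (z s)) ((hm t).toLp (z t)) = c (s - t) :=
    fun s t => by
      rw [inner_toLp, ← hcov, covariance_eq_sub (hm s) (hm t), hz.centered s, zero_mul, sub_zero]
      rfl
  have h01 : (hm 0).toLp (z 0) = (hm 1).toLp (z 1) := MemLp.toLp_congr _ _ hz.periodic
  -- Only the values of c on [-1,1] are constrained. Since z_0 = z_1 almost surely, they are
  -- compatible with period 1, so c may be replaced by its periodic extension from [0,1].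
  have hshift : ∀ t : I, c (1 - t) = c (-t) := fun t => by
    have h0 := hinner 0 t
    have h1 := hinner 1 t
    rw [← h01, h0] at h1
    simpa using h1.symm
  have hfr : ∀ u : ℝ, Int.fract u ∈ I := fun u => ⟨Int.fract_nonneg u, (Int.fract_lt_one u).le⟩
  have hC : Continuous fun u => c (Int.fract u) :=
    ContinuousOn.comp_fract'' hc.continuousOn (by simpa using (hshift 0).symm)
  have hper : Function.Periodic (fun u => c (Int.fract u)) 1 := fun u => by simp
  have hext : ∀ s t : I, c (s - t) = c (Int.fract ((s : ℝ) - t)) := fun s t => by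
    have hs := s.2
    have ht := t.2
    rcases lt_or_ge ((s : ℝ) - t) 0 with hd | hd
    · have hf : Int.fract ((s : ℝ) - t) = 1 - (t - s) :=
        Int.fract_eq_iff.2 ⟨by linarith [hs.1, ht.2], by linarith, -1, by push_cast; ring⟩
      have h := hshift ⟨t - s, by linarith, by linarith [hs.1, ht.2]⟩
      rw [hf, h]
      congr 1
      ring
    · rcases eq_or_lt_of_le (show (s : ℝ) - t ≤ 1 by linarith [hs.2, ht.1]) with h1 | h1
      · rw [h1, Int.fract_one]
        simpa using hshift 0
      · rw [Int.fract_eq_self.2 ⟨hd, h1⟩]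
  -- The process, extended to ℝ with period 1, is the curve in L² to which Bochner's theorem
  -- applies.
  have hzz : ∀ s t : ℝ, inner ℝ ((hm ⟨Int.fract s, hfr s⟩).toLp (z ⟨Int.fract s, hfr s⟩))
      ((hm ⟨Int.fract t, hfr t⟩).toLp (z ⟨Int.fract t, hfr t⟩)) = c (Int.fract (s - t)) :=
    fun s t => by
      rw [hinner, hext]
      congr 1
      refine Int.fract_eq_fract.2 ⟨⌊t⌋ - ⌊s⌋, ?_⟩
      simp only [Int.fract]
      push_cast
      ring
  obtain ⟨hnonneg, hsum, hcf⟩ := eq_covFun_sqrt_cosCoeff hC hper hzz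
  -- Summability of the coefficients is square-summability of their roots.
  have hmem : Memℓp (fun k => √(cosCoeff (fun u => c (Int.fract u)) k)) 2 :=
    memℓp_gen (by simpa [Real.sq_sqrt (hnonneg _)] using hsum)
  refine ⟨⟨_, hmem⟩, fun s t => ?_⟩
  rw [hcov, hext]
  exact congrFun hcf _

theorem IsGaussianCouple.exists_identDistrib {Y Y' : ℕ → Ω → ℝ} (hZ : IsGaussianCouple P Y Y')
    {Ω' : Type*} [MeasurableSpace Ω'] {P' : Measure Ω'} [IsProbabilityMeasure P']
    {z : I → Ω' → ℝ} (hz : MemH P' z) :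
    ∃ x ∈ HZ P Y Y', IdentDistrib (fun ω t => z t ω) (fun ω t => x t ω) P' P := by
  obtain ⟨a, ha⟩ := hz.exists_cov_eq_covFun
  obtain ⟨x, hx⟩ := exists_represents (hZ.process a)
  obtain ⟨hxH, hxa⟩ := (hZ.represents_process_iff a x).1 hx
  refine ⟨x, ⟨hxH, a, hxa⟩, identDistrib_of_isGaussianProcess hz.gaussian hxH.gaussian
    hz.measurable hxH.measurable (fun t => by rw [hz.centered, hxH.centered]) fun s t => ?_⟩
  have hm := hZ.memLp_of_represents hx
  rw [ha, covariance_eq_sub (hm s) (hm t), hxH.centered s, zero_mul, sub_zero]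
  exact (hZ.integral_mul_of_represents hx s t).symm

end Law

end GaussPeriodic

end

open GaussPeriodic in
theorem mainTheorem3 {Ω : Type*} [MeasurableSpace Ω] (P : Measure Ω) [IsProbabilityMeasure P]
    (Y Y' : ℕ → Ω → ℝ) (hZ : IsGaussianCouple P Y Y') :
    -- every process in `H`, on any probability space, has the law of a process in `H_Z`
    (∀ (Ω' : Type*) [MeasurableSpace Ω'] (P' : Measure Ω') [IsProbabilityMeasure P']
      (z : I → Ω' → ℝ), MemH P' z →
        ∃ x ∈ HZ P Y Y', IdentDistrib (fun ω t => z t ω) (fun ω t => x t ω) P' P) ∧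
    -- the map from coefficients to processes (up to modification) is a linear isometry
    -- of `ℓ²` onto `H_Z`
    (∃ Φ : EllTwo →ₗ[ℝ] ProcessClass Ω P,
      (∀ (a : EllTwo) (x : I → Ω → ℝ),
        Represents x (Φ a) ↔ MemH P x ∧ HasExpansion P Y Y' a x) ∧
      Function.Injective Φ ∧
      Set.range Φ = HZClass P Y Y' ∧
      (∀ (a : EllTwo) (x : I → Ω → ℝ), Represents x (Φ a) →
        (∀ t, MemLp (x t) 2 P) ∧
        Integrable (fun t : I => ∫ ω, x t ω * x t ω ∂P) ∧
        hNorm P x = coeffNorm a) ∧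
      (∀ (a b : EllTwo) (x y : I → Ω → ℝ), Represents x (Φ a) → Represents y (Φ b) →
        hNorm P (x - y) = coeffNorm (a - b))) := by
  exact ⟨fun _ _ _ _ _ hz => hZ.exists_identDistrib hz, hZ.process,
    hZ.represents_process_iff, hZ.process_injective, hZ.range_process,
    fun _ _ hx => ⟨hZ.memLp_of_represents hx, hZ.hNorm_of_represents hx⟩,
    fun _ _ _ _ hx hy => (hZ.hNorm_of_represents (hZ.represents_sub hx hy)).2⟩
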